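/- Let $q$ be an indeterminate. For an element $x$ of $\mathbb{Q}(q)$, an integer $m\ge 1$ and an integer $k\ge 0$ put $(x;q^m)_k=\prod_{j=0}^{k-1}(1-xq^{mj})$, and let $\Phi_n(q)$ be the $n$-th cyclotomic polynomial. For $f,g\in\mathbb{Q}(q)$ and a nonzero $P\in\mathbb{Q}[q]$, write $f\equiv g\pmod P$ if $f-g=Pu/v$ for some $u,v\in\mathbb{Q}[q]$ with $v\neq 0$ and $\gcd(v,P)=1$. (a) Let $d>r\ge 1$ be integers with $\gcd(d,r)=1$, and let $n>1$ be an integer with $n\equiv -r\pmod d$. Then $$\sum_{k=0}^{n-1}\frac{(q^{d+r};q^d)_k^{\,d-r-1}\,(q^r;q^d)_k^{\,r+1}\,q^{dk}}{(q^d;q^d)_k^{\,d}}\equiv\frac{(1-q^r)^{r+1}\,(q^d;q^d)_{n-1-(n+r)/d}}{(-1)^{n-1-(n+r)/d}\,(q^d;q^d)_{(n+r)/d}^{\,d-1}}\;q^{A(d,n,r)-r}\pmod{\Phi_n(q)^2},$$ where $$A(d,n,r)=\frac{d(d+n)(n+r)+dn(r-1)-(n+r)^2}{2d}-\frac{r(r+1)}{2},$$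 which is an integer. (b) In particular, for $r=1$: for every even integer $d\ge 4$ and every positive integer $n\equiv -1\pmod d$, $$\sum_{k=0}^{n-1}\frac{(q^{d+1};q^d)_k^{\,d-2}\,(q;q^d)_k^{\,2}\,q^{dk}}{(q^d;q^d)_k^{\,d}}\equiv\frac{(1-q)^2\,(q^d;q^d)_{n-1-(n+1)/d}}{(-1)^{(n+1)/d}\,(q^d;q^d)_{(n+1)/d}^{\,d-1}}\;q^{\frac{d(d+n)(n+1)-(n+1)^2}{2d}-2}\pmod{\Phi_n(q)^2}.$$ (c) Likewise, for every odd integer $d\ge 3$ and every positive integer $n\equiv -1\pmod d$, $$\sum_{k=0}^{n-1}\frac{(q^{d+1};q^d)_k^{\,d-2}\,(q;q^d)_k^{\,2}\,q^{dk}}{(q^d;q^d)_k^{\,d}}\equiv\frac{(1-q)^2\,(q^d;q^d)_{n-1-(n+1)/d}}{(q^d;q^d)_{(n+1)/d}^{\,d-1}}\;q^{\frac{d(d+n)(n+1)-(n+1)^2}{2d}-2}\pmod{\Phi_n(q)^2}.$$ -/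

import Mathlib

/-- The `q`-shifted factorial `(x;q)_k = (1 - x)(1 - xq) ⋯ (1 - xq^(k-1))` for `k ≥ 0`. -/
def qShifted {K : Type*} [CommRing K] (x q : K) (k : ℕ) : K :=
  ∏ j ∈ Finset.range k, (1 - x * q ^ j)

/-- The indeterminate `q` of the field `ℚ(q)` of rational functions. -/
noncomputable abbrev qv : RatFunc ℚ := RatFunc.X

/-- Congruence of rational functions modulo a polynomial: `f ≡ g (mod P)` in `ℚ(q)` when
`f - g = P * u / v` with polynomials `u`, `v` such that `v` is nonzero and coprime to `P`. -/
def RatCongr (P : Polynomial ℚ) (f g : RatFunc ℚ) : Prop :=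
  ∃ u v : Polynomial ℚ, v ≠ 0 ∧ IsCoprime v P ∧
    f - g = algebraMap (Polynomial ℚ) (RatFunc ℚ) (P * u) /
      algebraMap (Polynomial ℚ) (RatFunc ℚ) v

/-- `A(d,n,r) = [d(d+n)(n+r) + dn(r-1) - (n+r)^2] / (2d) - r(r+1)/2`.
Both integer divisions are exact when `n ≡ -r (mod d)`, see `exponentA_spec`. -/
def exponentA (d n r : ℤ) : ℤ :=
  (d * (d + n) * (n + r) + d * n * (r - 1) - (n + r) ^ 2) / (2 * d) - r * (r + 1) / 2

/-- The two integer divisions in `exponentA` are exact. -/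
theorem exponentA_spec (d n r : ℤ) (hd : 0 < d) (hn : n ≡ -r [ZMOD d]) :
    (exponentA d n r : ℚ) =
      ((d : ℚ) * (d + n) * (n + r) + d * n * (r - 1) - (n + r) ^ 2) / (2 * d)
        - r * (r + 1) / 2 := by
  obtain ⟨m, hm⟩ : d ∣ n + r := by
    have h := hn.symm.dvd
    rwa [sub_neg_eq_add] at h
  have h2 : (2 : ℤ) ∣ r * (r + 1) := (Int.even_mul_succ_self r).two_dvd
  have h1 : (2 * d) ∣ d * (d + n) * (n + r) + d * n * (r - 1) - (n + r) ^ 2 := by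
    have key : (2 : ℤ) ∣ (d + n) * (d * m) + n * (r - 1) - d * m ^ 2 := by
      obtain rfl : n = d * m - r := by linarith
      rw [← even_iff_two_dvd]
      by_cases hd : Even d <;> by_cases hm : Even m <;> by_cases hr : Even r <;>
        simp [hd, hm, hr, parity_simps, ← Int.not_even_iff_odd]
    obtain ⟨c, hc⟩ := key
    refine ⟨c, ?_⟩
    rw [hm]
    linear_combination d * hc
  have hd' : (d : ℚ) ≠ 0 := by exact_mod_cast hd.ne'
  unfold exponentA
  rw [Int.cast_sub, Int.cast_div h1 (by push_cast; positivity), Int.cast_div h2 (by norm_num)]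
  push_cast
  ring

/-!
Write `Q = q ^ d`, `x = q ^ r`, `y = q ^ n`, `m = (n + r) / d`, `N = n - m`. As
`(q ^ (d + r); Q)_k = (x; Q)_k (1 - x Q ^ k) / (1 - x)`, the `k`-th term of the sum is
`(x; Q)_k ^ d / (Q; Q)_k ^ d` times `((1 - x Q ^ k) / (1 - x)) ^ (d - r - 1) Q ^ k`.

Since `y ≡ 1` modulo `Φ_n(q)` and the exponents `-(d - 1), 1, …, 1` add up to zero,
`(x y ^ (-(d - 1)); Q)_k (x y; Q)_k ^ (d - 1) ≡ (x; Q)_k ^ d` modulo `Φ_n(q) ^ 2`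
(`dvd_qShifted_mul_qShifted_pow_sub`), and here `x y ^ (-(d - 1)) = Q ^ (-N)` and `x y = Q ^ m`.
After this replacement the sum terminates, and `((Q ^ m; Q)_k / (Q; Q)_k) ^ (d - 1)` times
`(1 - x Q ^ k) ^ (d - r - 1)` is a polynomial in `Q ^ k` of degree `(m - 1) (d - 1) + d - r - 1 = N`.
The sum is therefore an `N`-th `q`-difference of a polynomial of degree `N`, which by the
`q`-binomial theorem equals `(Q; Q)_N` times the leading coefficient
(`sum_qShifted_mul_pow_mul_pow`).

The value found in this way contains `(1 - Q ^ N) (1 - Q ^ m) ^ (d - 1)`, which is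
`-Q ^ N (1 - x y ^ (-(d - 1))) (1 - x y) ^ (d - 1) ≡ -Q ^ N (1 - x) ^ d`, by the same congruence for
`k = 1`; this gives the asserted right-hand side (`exists_mem_sum_qShifted_sub`). All quantities
lie in the ring of rational functions without poles at the primitive `n`-th roots of unity
(`regularSubring`), because `n` is coprime to `d` and does not divide `r`. The cases `r = 1` only
need the parity of `N - 1`.
-/

/-! ### Shifted factorials -/

theorem qShifted_zero {R : Type*} [CommRing R] (x q : R) : qShifted x q 0 = 1 := by
  simp [qShifted]

theorem qShifted_succ {R : Type*} [CommRing R] (x q : R) (k : ℕ) :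
    qShifted x q (k + 1) = qShifted x q k * (1 - x * q ^ k) :=
  Finset.prod_range_succ _ _

theorem qShifted_succ' {R : Type*} [CommRing R] (x q : R) (k : ℕ) :
    qShifted x q (k + 1) = (1 - x) * qShifted (x * q) q k := by
  simp only [qShifted, Finset.prod_range_succ', pow_zero, mul_one]
  rw [mul_comm]
  congr 1
  exact Finset.prod_congr rfl fun j _ => by ring

theorem qShifted_add {R : Type*} [CommRing R] (x q : R) (a b : ℕ) :
    qShifted x q (a + b) = qShifted x q a * qShifted (x * q ^ a) q b := by
  simp only [qShifted, Finset.prod_range_add]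
  congr 1
  exact Finset.prod_congr rfl fun j _ => by ring

theorem map_qShifted {R A : Type*} [CommRing R] [CommRing A] (f : R →+* A) (x q : R) (k : ℕ) :
    f (qShifted x q k) = qShifted (f x) (f q) k := by
  simp [qShifted]

/-- The left side has the same value and the same derivative at `y = 1` as the constant
`(1 - x) ^ (e + 1)`: the exponents `-e, 1, …, 1` of `y` add up to zero. -/
theorem dvd_one_sub_mul_one_sub_pow_sub {R : Type*} [CommRing R] {y z : R} (hyz : y * z = 1)
    (x : R) (e : ℕ) :
    (y - 1) ^ 2 ∣ (1 - x * z ^ e) * (1 - x * y) ^ e - (1 - x) ^ (e + 1) := by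
  obtain ⟨k, hk⟩ := Polynomial.powAddExpansion 1 (y - 1) e
  obtain ⟨l, hl⟩ := Polynomial.powAddExpansion (1 - x) (-x * (y - 1)) e
  have h1 : y ^ e = 1 + e * (y - 1) + k * (y - 1) ^ 2 := by
    simpa using hk
  have h2 : (1 - x * y) ^ e
      = (1 - x) ^ e - e * (1 - x) ^ (e - 1) * (x * (y - 1)) + l * x ^ 2 * (y - 1) ^ 2 := by
    rw [show 1 - x * y = 1 - x + -x * (y - 1) by ring, hl]; ring
  have hze : y ^ e * z ^ e = 1 := by rw [← mul_pow, hyz, one_pow]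
  have h3 : (e : R) * (1 - x) ^ (e - 1) * (1 - x) = e * (1 - x) ^ e := by
    rcases e with _ | e
    · simp
    · simp [pow_succ, mul_assoc]
  -- multiply by the unit `y ^ e`, which is linear in `y - 1` up to second order
  have h4 : (y - 1) ^ 2 ∣ (y ^ e - x) * (1 - x * y) ^ e - y ^ e * (1 - x) ^ (e + 1) := by
    refine ⟨k * (1 - x * y) ^ e + (1 - x) * l * x ^ 2
      + e * (y - 1) * l * x ^ 2 - e * (e * (1 - x) ^ (e - 1) * x) - k * (1 - x) ^ (e + 1), ?_⟩
    rw [h1, h2]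
    linear_combination (-x * (y - 1)) * h3
  have h5 : (1 - x * z ^ e) * (1 - x * y) ^ e - (1 - x) ^ (e + 1)
      = ((y ^ e - x) * (1 - x * y) ^ e - y ^ e * (1 - x) ^ (e + 1)) * z ^ e := by
    linear_combination (-(1 - x * y) ^ e + (1 - x) ^ (e + 1)) * hze
  rw [h5]
  exact h4.mul_right _

theorem dvd_qShifted_mul_qShifted_pow_sub {R : Type*} [CommRing R] {y z P : R} (hyz : y * z = 1)
    (hP : P ∣ (y - 1) ^ 2) (x Q : R) (e k : ℕ) :
    P ∣ qShifted (x * z ^ e) Q k * qShifted (x * y) Q k ^ e - qShifted x Q k ^ (e + 1) := by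
  rw [← Ideal.mem_span_singleton, ← Ideal.Quotient.eq]
  simp only [qShifted, ← Finset.prod_pow, ← Finset.prod_mul_distrib, map_prod]
  refine Finset.prod_congr rfl fun j _ => ?_
  rw [Ideal.Quotient.eq, Ideal.mem_span_singleton]
  have := hP.trans (dvd_one_sub_mul_one_sub_pow_sub hyz (x * Q ^ j) e)
  rwa [mul_right_comm x _ (z ^ e), mul_right_comm x _ y] at this

/-! ### Terminating basic hypergeometric sums -/

section Summation

variable {K : Type*} [Field K] {Q : K}

theorem qShifted_self_ne_zero (hQ : ∀ j : ℕ, Q ^ (j + 1) ≠ 1) (k : ℕ) : qShifted Q Q k ≠ 0 := by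
  refine Finset.prod_ne_zero_iff.2 fun j _ h => hQ j ?_
  rw [pow_succ']
  exact (sub_eq_zero.1 h).symm

theorem qShifted_inv_pow_eq_zero (hQ0 : Q ≠ 0) {N k : ℕ} (h : N < k) :
    qShifted (Q⁻¹ ^ N) Q k = 0 := by
  refine Finset.prod_eq_zero (Finset.mem_range.2 h) ?_
  rw [← mul_pow, inv_mul_cancel₀ hQ0, one_pow, sub_self]

/-- The terminating `q`-binomial theorem, `∑ (Q^(-N); Q)_k / (Q; Q)_k z^k = (z Q^(-N); Q)_N`. -/
theorem sum_qShifted_inv_pow_mul_pow (hQ0 : Q ≠ 0) (hQ : ∀ j : ℕ, Q ^ (j + 1) ≠ 1) (z : K)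
    (N : ℕ) :
    ∑ k ∈ Finset.range (N + 1), qShifted (Q⁻¹ ^ N) Q k / qShifted Q Q k * z ^ k
      = ∏ i ∈ Finset.range N, (1 - z * Q⁻¹ ^ (i + 1)) := by
  induction N with
  | zero => simp [qShifted_zero]
  | succ N ih =>
    rw [Finset.prod_range_succ, ← ih, mul_sub, mul_one, Finset.sum_mul]
    have hext : ∑ k ∈ Finset.range (N + 1), qShifted (Q⁻¹ ^ N) Q k / qShifted Q Q k * z ^ k
        = ∑ k ∈ Finset.range (N + 2), qShifted (Q⁻¹ ^ N) Q k / qShifted Q Q k * z ^ k := by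
      rw [Finset.sum_range_succ _ (N + 1), qShifted_inv_pow_eq_zero hQ0 (Nat.lt_succ_self N)]
      simp
    rw [hext, Finset.sum_range_succ' _ (N + 1), Finset.sum_range_succ' _ (N + 1),
      add_sub_right_comm, ← Finset.sum_sub_distrib]
    simp only [qShifted_zero]
    congr 1
    refine Finset.sum_congr rfl fun k _ => ?_
    have h1 := qShifted_self_ne_zero hQ k
    have h2 : 1 - Q * Q ^ k ≠ 0 := by
      rw [← pow_succ', sub_ne_zero]
      exact (hQ k).symm
    rw [qShifted_succ' (Q⁻¹ ^ (N + 1)), qShifted_succ (Q⁻¹ ^ N), qShifted_succ Q,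
      show Q⁻¹ ^ (N + 1) * Q = Q⁻¹ ^ N by rw [pow_succ, mul_assoc, inv_mul_cancel₀ hQ0, mul_one]]
    have h3 : Q⁻¹ ^ N = Q⁻¹ ^ (N + 1) * Q := by
      rw [pow_succ, mul_assoc, inv_mul_cancel₀ hQ0, mul_one]
    generalize Q⁻¹ ^ (N + 1) = w at *
    generalize qShifted (Q⁻¹ ^ N) Q k = v at *
    rw [h3]
    field_simp
    ring

/-- The functional `p ↦ ∑ (Q^(-N); Q)_k / (Q; Q)_k Q^k p(Q^k)`, an `N`-th `q`-difference, kills the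
monomials of degree below `N`: at `z = Q ^ (i + 1)` with `i < N` the product of the `q`-binomial
theorem has a zero factor. -/
theorem sum_qShifted_inv_pow_mul_eval (hQ0 : Q ≠ 0) (hQ : ∀ j : ℕ, Q ^ (j + 1) ≠ 1) {N : ℕ}
    {p : Polynomial K} (hp : p.natDegree ≤ N) :
    ∑ k ∈ Finset.range (N + 1), qShifted (Q⁻¹ ^ N) Q k / qShifted Q Q k * Q ^ k * p.eval (Q ^ k)
      = p.coeff N * qShifted Q Q N := by
  simp_rw [Polynomial.eval_eq_sum_range' (Nat.lt_succ_of_le hp), Finset.mul_sum]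
  rw [Finset.sum_comm]
  have key : ∀ i, ∑ k ∈ Finset.range (N + 1), qShifted (Q⁻¹ ^ N) Q k / qShifted Q Q k * Q ^ k
      * (p.coeff i * (Q ^ k) ^ i)
      = p.coeff i * ∏ j ∈ Finset.range N, (1 - Q ^ (i + 1) * Q⁻¹ ^ (j + 1)) := fun i => by
    rw [← sum_qShifted_inv_pow_mul_pow hQ0 hQ, Finset.mul_sum]
    exact Finset.sum_congr rfl fun k _ => by ring
  simp_rw [key]
  rw [Finset.sum_range_succ, Finset.sum_eq_zero, zero_add]
  · congr 1
    rw [qShifted, ← Finset.prod_range_reflect]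
    refine Finset.prod_congr rfl fun j hj => ?_
    have hj := Finset.mem_range.1 hj
    rw [show N + 1 = j + 1 + (N - 1 - j + 1) by omega, pow_add, mul_assoc, ← mul_pow,
      mul_inv_cancel₀ hQ0, one_pow, mul_one, pow_succ']
  · intro i hi
    rw [Finset.prod_eq_zero hi, mul_zero]
    rw [← mul_pow, mul_inv_cancel₀ hQ0, one_pow, sub_self]

theorem qShifted_pow_div_qShifted (hQ : ∀ j : ℕ, Q ^ (j + 1) ≠ 1) (s k : ℕ) :
    qShifted (Q ^ (s + 1)) Q k / qShifted Q Q k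
      = qShifted (Q * Q ^ k) Q s / qShifted Q Q s := by
  rw [div_eq_div_iff (qShifted_self_ne_zero hQ k) (qShifted_self_ne_zero hQ s), pow_succ',
    mul_comm, ← qShifted_add, mul_comm, ← qShifted_add, add_comm]

open Polynomial in
/-- A sum of Karlsson–Minton type. Since `(Q ^ (s + 1); Q)_k / (Q; Q)_k` is a polynomial of degree
`s` in `Q ^ k`, the summand is `(Q^(-N); Q)_k / (Q; Q)_k Q^k` times a polynomial in `Q ^ k` of degree
exactly `N = s * e + b`, so that only the leading coefficient contributes. -/
theorem sum_qShifted_mul_pow_mul_pow (hQ0 : Q ≠ 0) (hQ : ∀ j : ℕ, Q ^ (j + 1) ≠ 1)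
    (c : K) (s e b n : ℕ) (hn : s * e + b < n) :
    ∑ k ∈ Finset.range n, qShifted (Q⁻¹ ^ (s * e + b)) Q k * qShifted (Q ^ (s + 1)) Q k ^ e
        * (1 - c * Q ^ k) ^ b * Q ^ k / qShifted Q Q k ^ (e + 1)
      = ((-1) ^ s * Q ^ (s * (s + 1) / 2) / qShifted Q Q s) ^ e * (-c) ^ b
        * qShifted Q Q (s * e + b) := by
  let f : K[X] := ∏ i ∈ Finset.range s, (1 - C (Q ^ (i + 1)) * X)
  let p : K[X] := (C (qShifted Q Q s)⁻¹ * f) ^ e * (1 - C c * X) ^ b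
  have hlin : ∀ a : K, (1 - C a * X : K[X]).natDegree ≤ 1 := fun a => by compute_degree
  have hlc : ∀ a : K, (1 - C a * X : K[X]).coeff 1 = -a := fun a => by
    simp [coeff_one]
  have hf : f.natDegree ≤ s := by
    refine (natDegree_prod_le _ _).trans ((Finset.sum_le_sum fun i _ => hlin (Q ^ (i + 1))).trans ?_)
    simp
  have hfc : f.coeff s = (-1) ^ s * Q ^ (s * (s + 1) / 2) := by
    have := coeff_prod_of_natDegree_le (Finset.range s) (fun i => (1 - C (Q ^ (i + 1)) * X : K[X])) 1
      fun p hp => hlin (Q ^ (p + 1))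
    simp only [Finset.card_range, mul_one, hlc] at this
    rw [this, Finset.prod_neg, Finset.card_range, Finset.prod_pow_eq_pow_sum,
      ← Finset.sum_range_succ' (fun i => i) s |>.trans (add_zero _), Finset.sum_range_id,
      Nat.add_sub_cancel, mul_comm (s + 1)]
  have hg : (C (qShifted Q Q s)⁻¹ * f).natDegree ≤ s := (natDegree_C_mul_le _ _).trans hf
  have hge := natDegree_pow_le_of_le e hg
  have hlb := natDegree_pow_le_of_le b (hlin c)
  rw [mul_comm e] at hge
  rw [mul_one] at hlb
  have hp : p.natDegree ≤ s * e + b := natDegree_mul_le_of_le hge hlb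
  have hpc : p.coeff (s * e + b)
      = ((-1) ^ s * Q ^ (s * (s + 1) / 2) / qShifted Q Q s) ^ e * (-c) ^ b := by
    have h1 := coeff_pow_of_natDegree_le (m := e) hg
    have h2 := coeff_pow_of_natDegree_le (m := b) (hlin c)
    rw [mul_comm e] at h1
    rw [mul_one, hlc] at h2
    rw [coeff_mul_add_eq_of_natDegree_le hge hlb, h1, h2, coeff_C_mul, hfc]
    ring
  have hev : ∀ t, p.eval t = (qShifted (Q * t) Q s / qShifted Q Q s) ^ e * (1 - c * t) ^ b := by
    intro t
    have : f.eval t = qShifted (Q * t) Q s := by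
      simp only [f, eval_prod, qShifted]
      exact Finset.prod_congr rfl fun i _ => by simp; ring
    simp only [p, eval_mul, eval_pow, eval_C, this, eval_sub, eval_one, eval_X]
    ring
  rw [← hpc, ← sum_qShifted_inv_pow_mul_eval hQ0 hQ hp]
  symm
  refine (Finset.sum_subset (Finset.range_subset_range.2 hn) fun k _ hk => ?_).trans
    (Finset.sum_congr rfl fun k _ => ?_)
  -- the sum terminates: the terms with `k > s * e + b` vanish
  · rw [qShifted_inv_pow_eq_zero hQ0 (by simpa using hk)]
    simp
  · rw [hev, ← qShifted_pow_div_qShifted hQ]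
    rw [div_pow, pow_succ']
    ring

end Summation

/-! ### The congruence over a field with a distinguished subring -/

section Congruence

variable {K : Type*} [Field K]

/-- `dvd_qShifted_mul_qShifted_pow_sub` with `z = y⁻¹` for elements of a field; the congruence is
modulo `P` in a subring `S`. -/
theorem exists_mem_qShifted_mul_qShifted_pow_sub {S : Subring K} {x y P Q : K} (hx : x ∈ S)
    (hy : y ∈ S) (hy' : y⁻¹ ∈ S) (hQS : Q ∈ S) (hPS : P ∈ S) (hy0 : y ≠ 0)
    (hP : ∃ w ∈ S, (y - 1) ^ 2 = P * w) (e k : ℕ) :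
    ∃ w ∈ S, qShifted (x * y⁻¹ ^ e) Q k * qShifted (x * y) Q k ^ e - qShifted x Q k ^ (e + 1)
      = P * w := by
  obtain ⟨w, hw, hPw⟩ := hP
  obtain ⟨c, hc⟩ := dvd_qShifted_mul_qShifted_pow_sub (R := S) (y := ⟨y, hy⟩) (z := ⟨y⁻¹, hy'⟩)
    (P := ⟨P, hPS⟩) (Subtype.ext (mul_inv_cancel₀ hy0)) ⟨⟨w, hw⟩, Subtype.ext hPw⟩
    ⟨x, hx⟩ ⟨Q, hQS⟩ e k
  refine ⟨c, c.2, ?_⟩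
  simpa only [map_sub, map_mul, map_pow, map_qShifted, Subring.subtype_apply] using
    congrArg S.subtype hc

theorem qShifted_mem {S : Subring K} {x Q : K} (hx : x ∈ S) (hQ : Q ∈ S) (k : ℕ) :
    qShifted x Q k ∈ S :=
  S.prod_mem fun j _ => S.sub_mem S.one_mem (S.mul_mem hx (S.pow_mem hQ j))

/-- The congruence with `Q`, `x`, `y` for `q ^ d`, `q ^ r`, `q ^ n`, with `b = d - r - 1`,
`s + 1 = (n + r) / d` and `N + 1 = n - (n + r) / d`. The two sides are congruent modulo `P` in the
subring `S`. -/
theorem exists_mem_sum_qShifted_sub {S : Subring K} {x y P Q : K} (hx : x ∈ S)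
    (hy : y ∈ S) (hy' : y⁻¹ ∈ S) (hQS : Q ∈ S) (hPS : P ∈ S) (hy0 : y ≠ 0)
    (hP : ∃ w ∈ S, (y - 1) ^ 2 = P * w) (hQ0 : Q ≠ 0) (hQ : ∀ j : ℕ, Q ^ (j + 1) ≠ 1)
    (hx1 : 1 - x ≠ 0) (hx1' : (1 - x)⁻¹ ∈ S) {n : ℕ}
    (hQinv : ∀ j : ℕ, j + 1 < n → (1 - Q * Q ^ j)⁻¹ ∈ S) {b r s N : ℕ}
    (hN : s * (b + r) + b = N + 1) (hNn : N + 1 < n) (hsn : s + 1 < n)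
    (hxy : x * y = Q ^ (s + 1)) (hQN : Q ^ (N + 1) * x = y ^ (b + r)) :
    ∃ w ∈ S, ∑ k ∈ Finset.range n, qShifted (Q * x) Q k ^ b * qShifted x Q k ^ (r + 1) * Q ^ k
          / qShifted Q Q k ^ (b + r + 1)
        - (1 - x) ^ (r + 1) * qShifted Q Q N / ((-1) ^ N * qShifted Q Q (s + 1) ^ (b + r))
          * (Q ^ (N + 1) * (Q ^ (s * (s + 1) / 2)) ^ (b + r) * x ^ b) = P * w := by
  set e := b + r with he
  have hQk : ∀ k < n, (qShifted Q Q k)⁻¹ ∈ S := fun k hk => by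
    rw [qShifted, ← Finset.prod_inv_distrib]
    exact S.prod_mem fun j hj => hQinv j (by have := Finset.mem_range.1 hj; omega)
  have hne := qShifted_self_ne_zero hQ
  have hz : x * y⁻¹ ^ e = Q⁻¹ ^ (N + 1) := by
    have := pow_ne_zero (N + 1) hQ0
    have := pow_ne_zero e hy0
    rw [inv_pow, inv_pow]
    field_simp
    rw [← hQN]; ring
  choose w hwS hw using
    exists_mem_qShifted_mul_qShifted_pow_sub hx hy hy' hQS hPS hy0 hP e
  rw [hz, hxy] at hw
  -- `G k` collects the factors of the `k`-th term that the perturbation of `(x; Q)_k` leaves alone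
  obtain ⟨G, hG⟩ : ∃ G : ℕ → K, ∀ k, G k
      = (1 - x)⁻¹ ^ b * (1 - x * Q ^ k) ^ b * Q ^ k * (qShifted Q Q k)⁻¹ ^ (e + 1) :=
    ⟨_, fun _ => rfl⟩
  have hGS : ∀ k < n, G k ∈ S := fun k hk => by
    rw [hG]
    exact S.mul_mem (S.mul_mem (S.mul_mem (S.pow_mem hx1' _) (S.pow_mem (S.sub_mem S.one_mem
      (S.mul_mem hx (S.pow_mem hQS _))) _)) (S.pow_mem hQS _)) (S.pow_mem (hQk k hk) _)
  have hterm : ∀ k, qShifted (Q * x) Q k ^ b * qShifted x Q k ^ (r + 1) * Q ^ k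
      / qShifted Q Q k ^ (e + 1) = qShifted x Q k ^ (e + 1) * G k := fun k => by
    have h1 : qShifted (Q * x) Q k = (1 - x)⁻¹ * (qShifted x Q k * (1 - x * Q ^ k)) := by
      rw [← qShifted_succ, qShifted_succ', inv_mul_cancel_left₀ hx1, mul_comm Q]
    rw [hG, h1, he, mul_pow, mul_pow]
    ring
  have hexact := sum_qShifted_mul_pow_mul_pow hQ0 hQ x s e b n (by omega)
  have hperturbed : ∑ k ∈ Finset.range n, qShifted (Q⁻¹ ^ (N + 1)) Q k
      * qShifted (Q ^ (s + 1)) Q k ^ e * G k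
      = (1 - x)⁻¹ ^ b * (((-1) ^ s * Q ^ (s * (s + 1) / 2) / qShifted Q Q s) ^ e * (-x) ^ b
        * qShifted Q Q (N + 1)) := by
    rw [← hN, ← hexact, Finset.mul_sum]
    refine Finset.sum_congr rfl fun k _ => ?_
    rw [hG]
    ring
  -- the exact value of the perturbed sum is `v * (1 - Q ^ (-(N + 1))) * (1 - Q ^ (s + 1)) ^ e`, and
  -- the claimed value is `v * (1 - x) ^ (e + 1)`
  obtain ⟨v, hv⟩ : ∃ v, v = (1 - x)⁻¹ ^ b * (Q ^ (s * (s + 1) / 2)) ^ e * x ^ b * (-1) ^ N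
    * qShifted Q Q N * (qShifted Q Q (s + 1))⁻¹ ^ e * Q ^ (N + 1) := ⟨_, rfl⟩
  have hvS : v ∈ S := by
    rw [hv]
    exact S.mul_mem (S.mul_mem (S.mul_mem (S.mul_mem (S.mul_mem (S.mul_mem (S.pow_mem hx1' _)
      (S.pow_mem (S.pow_mem hQS _) _)) (S.pow_mem hx _)) (S.pow_mem (S.neg_mem S.one_mem) _))
      (qShifted_mem hQS hQS _)) (S.pow_mem (hQk _ hsn) _)) (S.pow_mem hQS _)
  refine ⟨v * w 1 - ∑ k ∈ Finset.range n, w k * G k, S.sub_mem (S.mul_mem hvS (hwS 1))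
    (S.sum_mem fun k hk => S.mul_mem (hwS k) (hGS k (Finset.mem_range.1 hk))), ?_⟩
  -- replace `(x; Q)_k ^ (e + 1)` by `(Q ^ (-(N + 1)); Q)_k * (Q ^ (s + 1); Q)_k ^ e`
  have hsum : ∑ k ∈ Finset.range n, qShifted x Q k ^ (e + 1) * G k
      = ∑ k ∈ Finset.range n, qShifted (Q⁻¹ ^ (N + 1)) Q k * qShifted (Q ^ (s + 1)) Q k ^ e * G k
        - P * ∑ k ∈ Finset.range n, w k * G k := by
    rw [Finset.mul_sum, ← Finset.sum_sub_distrib]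
    refine Finset.sum_congr rfl fun k _ => ?_
    linear_combination (-G k) * hw k
  have hmain : (1 - x)⁻¹ ^ b * (((-1) ^ s * Q ^ (s * (s + 1) / 2) / qShifted Q Q s) ^ e * (-x) ^ b
        * qShifted Q Q (N + 1))
      - (1 - x) ^ (r + 1) * qShifted Q Q N / ((-1) ^ N * qShifted Q Q (s + 1) ^ e)
          * (Q ^ (N + 1) * (Q ^ (s * (s + 1) / 2)) ^ e * x ^ b)
      = v * (P * w 1) := by
    have hs1 : qShifted Q Q (s + 1) = qShifted Q Q s * (1 - Q ^ (s + 1)) := by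
      rw [qShifted_succ, pow_succ']
    have hN1 : qShifted Q Q (N + 1) = - (qShifted Q Q N * Q ^ (N + 1) * (1 - Q⁻¹ ^ (N + 1))) := by
      have : Q ^ (N + 1) * Q⁻¹ ^ (N + 1) = 1 := by rw [← mul_pow, mul_inv_cancel₀ hQ0, one_pow]
      rw [qShifted_succ]
      linear_combination (-qShifted Q Q N) * this
    have hs2 : (qShifted Q Q s)⁻¹ = (qShifted Q Q (s + 1))⁻¹ * (1 - Q ^ (s + 1)) := by
      have h1 := hne (s + 1)
      rw [hs1] at h1 ⊢
      have := left_ne_zero_of_mul h1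
      have := right_ne_zero_of_mul h1
      field_simp
    have hsign : ((-1 : K) ^ s) ^ e * (-1) ^ b = -(-1) ^ N := by
      rw [← pow_mul, ← pow_add, hN, pow_succ, mul_neg_one]
    have hxr : (1 - x) ^ (r + 1) = (1 - x)⁻¹ ^ b * (1 - x) ^ (e + 1) := by
      rw [he, add_assoc, pow_add _ b, ← mul_assoc, ← mul_pow, inv_mul_cancel₀ hx1, one_pow, one_mul]
    have hNinv : ((-1 : K) ^ N)⁻¹ = (-1) ^ N := by rw [← inv_pow, inv_neg, inv_one]
    -- the two values differ by the perturbation of the single factor `1 - x`: the case `k = 1`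
    have hw1 := hw 1
    simp only [qShifted_succ, qShifted_zero, pow_zero, mul_one, one_mul] at hw1
    rw [← hw1, hv, hN1, hxr, div_eq_mul_inv _ (qShifted Q Q s), hs2, div_eq_mul_inv, mul_inv,
      hNinv, neg_pow x, ← inv_pow, mul_pow, mul_pow, mul_pow _ (1 - Q ^ (s + 1))]
    linear_combination (-(1 - x)⁻¹ ^ b * (Q ^ (s * (s + 1) / 2)) ^ e * x ^ b
      * qShifted Q Q N * (qShifted Q Q (s + 1))⁻¹ ^ e * Q ^ (N + 1) * (1 - Q⁻¹ ^ (N + 1))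
      * (1 - Q ^ (s + 1)) ^ e) * hsign
  simp_rw [hterm]
  rw [hsum, hperturbed]
  linear_combination hmain

end Congruence

/-! ### Rational functions regular at the primitive `n`-th roots of unity -/

section RegularFunctions
open Polynomial

/-- The rational functions with a denominator coprime to `P`: the localization of `ℚ[q]` at the
polynomials prime to `P`, as a subring of `ℚ(q)`. -/
def regularSubring (P : ℚ[X]) : Subring (RatFunc ℚ) where
  carrier := {f | ∃ u v : ℚ[X], v ≠ 0 ∧ IsCoprime v P ∧
    f = algebraMap ℚ[X] (RatFunc ℚ) u / algebraMap ℚ[X] (RatFunc ℚ) v}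
  zero_mem' := ⟨0, 1, one_ne_zero, isCoprime_one_left, by simp⟩
  one_mem' := ⟨1, 1, one_ne_zero, isCoprime_one_left, by simp⟩
  add_mem' := by
    rintro _ _ ⟨u, v, hv, hvP, rfl⟩ ⟨u', v', hv', hvP', rfl⟩
    refine ⟨u * v' + v * u', v * v', mul_ne_zero hv hv', hvP.mul_left hvP', ?_⟩
    rw [div_add_div _ _ (RatFunc.algebraMap_ne_zero hv) (RatFunc.algebraMap_ne_zero hv')]
    simp
  mul_mem' := by
    rintro _ _ ⟨u, v, hv, hvP, rfl⟩ ⟨u', v', hv', hvP', rfl⟩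
    refine ⟨u * u', v * v', mul_ne_zero hv hv', hvP.mul_left hvP', ?_⟩
    rw [div_mul_div_comm]
    simp
  neg_mem' := by
    rintro _ ⟨u, v, hv, hvP, rfl⟩
    exact ⟨-u, v, hv, hvP, by rw [map_neg, neg_div]⟩

theorem algebraMap_mem_regularSubring (P u : ℚ[X]) :
    algebraMap ℚ[X] (RatFunc ℚ) u ∈ regularSubring P :=
  ⟨u, 1, one_ne_zero, isCoprime_one_left, by simp⟩

theorem inv_algebraMap_mem_regularSubring {P v : ℚ[X]} (hv : v ≠ 0) (hvP : IsCoprime v P) :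
    (algebraMap ℚ[X] (RatFunc ℚ) v)⁻¹ ∈ regularSubring P :=
  ⟨1, v, hv, hvP, by simp⟩

theorem ratCongr_of_exists_mem {P : ℚ[X]} {f g : RatFunc ℚ}
    (h : ∃ w ∈ regularSubring P, f - g = algebraMap ℚ[X] (RatFunc ℚ) P * w) : RatCongr P f g := by
  obtain ⟨_, ⟨u, v, hv, hvP, rfl⟩, h⟩ := h
  exact ⟨u, v, hv, hvP, by rw [h, map_mul, mul_div_assoc]⟩

theorem isCoprime_X_pow_sub_one_cyclotomic {n t : ℕ} (ht : ¬ n ∣ t) :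
    IsCoprime (X ^ t - 1 : ℚ[X]) (cyclotomic n ℚ) := by
  have ht0 : 0 < t := Nat.pos_of_ne_zero fun h => ht (h ▸ dvd_zero n)
  rw [← prod_cyclotomic_eq_X_pow_sub_one ht0]
  refine IsCoprime.prod_left fun i hi => cyclotomic.isCoprime_rat ?_
  rintro rfl
  exact ht (Nat.dvd_of_mem_divisors hi)

theorem isCoprime_X_cyclotomic {n : ℕ} (hn : 0 < n) : IsCoprime (X : ℚ[X]) (cyclotomic n ℚ) := by
  obtain ⟨c, hc⟩ := cyclotomic.dvd_X_pow_sub_one n ℚ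
  obtain ⟨k, rfl⟩ : ∃ k, n = k + 1 := ⟨n - 1, by omega⟩
  exact ⟨X ^ k, -c, by linear_combination hc⟩

theorem qv_pow_ne_one {t : ℕ} (ht : 0 < t) : qv ^ t ≠ 1 := by
  intro h
  have h' : algebraMap ℚ[X] (RatFunc ℚ) (X ^ t - 1) = 0 := by simp [h]
  exact (monic_X_pow_sub_C (1 : ℚ) ht.ne').ne_zero
    (by simpa using (map_eq_zero_iff _ (RatFunc.algebraMap_injective ℚ)).1 h')

theorem inv_one_sub_qv_pow_mem {n t : ℕ} (ht : ¬ n ∣ t) :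
    (1 - qv ^ t)⁻¹ ∈ regularSubring (cyclotomic n ℚ ^ 2) := by
  have ht0 : 0 < t := Nat.pos_of_ne_zero fun h => ht (h ▸ dvd_zero n)
  have h0 : (1 - X ^ t : ℚ[X]) ≠ 0 := fun h => qv_pow_ne_one ht0 <| by
    have := congrArg (algebraMap ℚ[X] (RatFunc ℚ)) h
    simp only [map_sub, map_one, map_pow, RatFunc.algebraMap_X, map_zero] at this
    exact (sub_eq_zero.1 this).symm
  have := inv_algebraMap_mem_regularSubring h0 (P := cyclotomic n ℚ ^ 2) <| by
    rw [← neg_sub]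
    exact (isCoprime_X_pow_sub_one_cyclotomic ht).neg_left.pow_right
  simpa using this

end RegularFunctions

/-! ### The congruence modulo the square of a cyclotomic polynomial -/

/-- The exponent of `q` in the congruence, in the form in which the evaluation produces it: with
`s + 1 = (n + r) / d` and `b = d - r - 1` it is the exponent in
`Q ^ (N + 1) * (Q ^ (s (s + 1) / 2)) ^ (b + r) * x ^ b` for `Q = q ^ d` and `x = q ^ r`. -/
theorem exponentA_sub_eq {r s b N : ℕ} (hN : s * (b + r) + b = N + 1) {d n : ℕ}
    (hd : d = b + r + 1) (hn : n + r = d * (s + 1)) :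
    exponentA d n r - r
      = ((d * (N + 1) + d * (s * (s + 1) / 2) * (b + r) + r * b : ℕ) : ℤ) := by
  have hdpos : (0 : ℚ) < d := by rw [hd]; positivity
  obtain ⟨T, hT⟩ : 2 ∣ s * (s + 1) := (Nat.even_mul_succ_self s).two_dvd
  rw [hT, Nat.mul_div_cancel_left _ two_pos]
  have h := exponentA_spec d n r (by exact_mod_cast hdpos) (by
    rw [Int.modEq_comm, Int.modEq_iff_dvd, sub_neg_eq_add]
    exact ⟨(s : ℤ) + 1, by exact_mod_cast hn⟩)
  rw [← Int.cast_inj (α := ℚ)]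
  push_cast at h ⊢
  rw [h]
  have hT' : (s : ℚ) * (s + 1) = 2 * T := by exact_mod_cast hT
  have hT'' : (T : ℚ) = s * (s + 1) / 2 := by rw [hT']; ring
  have hn' : (n : ℚ) = d * (s + 1) - r := by rw [eq_sub_iff_add_eq]; exact_mod_cast hn
  have hN' : (N : ℚ) + 1 = s * (b + r) + b := by exact_mod_cast hN.symm
  rw [hN', hT'', hn']
  have hd' : (d : ℚ) = b + r + 1 := by exact_mod_cast hd
  rw [hd'] at hdpos ⊢
  field_simp
  ring

open Polynomial in
theorem ratCongr_sum_qShifted {d r n : ℕ} (hr : 1 ≤ r) (hrd : r < d) (hdr : Nat.gcd d r = 1)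
    (hn : 1 < n) (hmod : (n : ℤ) ≡ -(r : ℤ) [ZMOD (d : ℤ)]) :
    RatCongr (cyclotomic n ℚ ^ 2)
      (∑ k ∈ Finset.range n,
        qShifted (qv ^ (d + r)) (qv ^ d) k ^ (d - r - 1) * qShifted (qv ^ r) (qv ^ d) k ^ (r + 1)
          * qv ^ (d * k) / qShifted (qv ^ d) (qv ^ d) k ^ d)
      ((1 - qv ^ r) ^ (r + 1) * qShifted (qv ^ d) (qv ^ d) (n - 1 - (n + r) / d)
          / ((-1) ^ (n - 1 - (n + r) / d) * qShifted (qv ^ d) (qv ^ d) ((n + r) / d) ^ (d - 1))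
        * qv ^ (exponentA d n r - r)) := by
  obtain ⟨m, hm⟩ : d ∣ n + r := by
    have h := hmod.symm.dvd
    rw [sub_neg_eq_add] at h
    exact_mod_cast h
  obtain ⟨b, rfl⟩ : ∃ b, d = b + r + 1 := ⟨d - r - 1, by omega⟩
  obtain ⟨s, rfl⟩ : ∃ s, m = s + 1 := ⟨m - 1, by
    rcases m with _ | m
    · omega
    · omega⟩
  have hnd : Nat.Coprime n (b + r + 1) := by
    have h : Nat.gcd n (b + r + 1) ∣ r := (Nat.dvd_add_right (Nat.gcd_dvd_left n _)).1
      (hm ▸ (Nat.gcd_dvd_right n _).mul_right _)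
    exact Nat.eq_one_of_dvd_one ((Nat.dvd_gcd (Nat.gcd_dvd_right n _) h).trans hdr.dvd)
  have hsn : s + 1 < n := by
    by_contra! h
    have : (b + r + 1) * n ≤ n + r := hm ▸ Nat.mul_le_mul_left _ h
    nlinarith
  have hN1 : n = s * (b + r) + b + (s + 1) := by
    have : n + r = s * (b + r) + b + (s + 1) + r := by rw [hm]; ring
    omega
  obtain ⟨N, hN⟩ : ∃ N, s * (b + r) + b = N + 1 := ⟨n - (s + 1) - 1, by omega⟩
  have hq : qv ≠ 0 := RatFunc.X_ne_zero
  have hqS : qv ∈ regularSubring (cyclotomic n ℚ ^ 2) := by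
    simpa using algebraMap_mem_regularSubring (cyclotomic n ℚ ^ 2) X
  have hqS' : qv⁻¹ ∈ regularSubring (cyclotomic n ℚ ^ 2) := by
    simpa using inv_algebraMap_mem_regularSubring X_ne_zero
      ((isCoprime_X_cyclotomic (by omega : 0 < n)).pow_right (n := 2))
  -- `1 - q ^ r` must be invertible at the primitive `n`-th roots of unity
  have hnr : ¬ n ∣ r := fun h => by
    have h1 : n ∣ (b + r + 1) * (s + 1) := hm ▸ (Nat.dvd_add_right dvd_rfl).2 h
    exact absurd (Nat.le_of_dvd (Nat.succ_pos s) (hnd.dvd_of_dvd_mul_left h1)) (by omega)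
  have hmain := exists_mem_sum_qShifted_sub (S := regularSubring (cyclotomic n ℚ ^ 2))
    (x := qv ^ r) (y := qv ^ n) (Q := qv ^ (b + r + 1)) (b := b) (r := r) (s := s) (N := N) (n := n)
    (P := algebraMap ℚ[X] (RatFunc ℚ) (cyclotomic n ℚ ^ 2))
    (Subring.pow_mem _ hqS _) (Subring.pow_mem _ hqS _)
    (by rw [← inv_pow]; exact Subring.pow_mem _ hqS' _) (Subring.pow_mem _ hqS _)
    (algebraMap_mem_regularSubring _ _) (pow_ne_zero _ hq)
    (by
      obtain ⟨c, hc⟩ := cyclotomic.dvd_X_pow_sub_one n ℚ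
      refine ⟨_, algebraMap_mem_regularSubring _ (c ^ 2), ?_⟩
      rw [← map_mul, ← mul_pow, ← hc]
      simp)
    (pow_ne_zero _ hq)
    (fun j => by rw [← pow_mul]; exact qv_pow_ne_one (by positivity))
    (sub_ne_zero.2 (qv_pow_ne_one hr).symm) (inv_one_sub_qv_pow_mem hnr)
    (fun j hj => by
      rw [← pow_succ', ← pow_mul]
      refine inv_one_sub_qv_pow_mem fun h => ?_
      exact absurd (Nat.le_of_dvd (Nat.succ_pos j) (hnd.dvd_of_dvd_mul_left h)) (by omega))
    hN (by omega) hsn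
    (by rw [← pow_add, ← pow_mul, ← hm, add_comm])
    (by
      rw [← pow_mul, ← pow_mul, ← pow_add, ← hN]
      congr 1
      rw [hN1]
      ring)
  have hexp : qv ^ (exponentA ((b + r + 1 : ℕ) : ℤ) n r - r) = (qv ^ (b + r + 1)) ^ (N + 1)
      * ((qv ^ (b + r + 1)) ^ (s * (s + 1) / 2)) ^ (b + r) * (qv ^ r) ^ b := by
    rw [exponentA_sub_eq hN rfl hm, zpow_natCast, pow_add, pow_add]
    simp only [pow_mul]
  have hdiv : (n + r) / (b + r + 1) = s + 1 := by
    rw [hm, Nat.mul_div_cancel_left _ (Nat.succ_pos _)]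
  rw [hdiv, hexp, show n - 1 - (s + 1) = N by omega, show b + r + 1 - r - 1 = b by omega,
    show b + r + 1 - 1 = b + r by omega]
  refine ratCongr_of_exists_mem ?_
  simpa only [pow_mul, pow_add qv (b + r + 1) r] using hmain

theorem exponentA_one_sub_one (d n : ℤ) :
    exponentA d n 1 - 1 = (d * (d + n) * (n + 1) - (n + 1) ^ 2) / (2 * d) - 2 := by
  simp only [exponentA, sub_self, mul_zero, add_zero]
  omega

theorem theorem4p2 :
    -- the congruence for all `d > r ≥ 1`; here `(n + r) / d` is an exact quotient and the
    -- subtractions `d - r - 1`, `d - 1`, `n - 1 - (n + r) / d` have nonnegative values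
    (∀ d r n : ℕ, 1 ≤ r → r < d → Nat.gcd d r = 1 → 1 < n → (n : ℤ) ≡ -(r : ℤ) [ZMOD (d : ℤ)] →
      RatCongr (Polynomial.cyclotomic n ℚ ^ 2)
        (∑ k ∈ Finset.range n,
          qShifted (qv ^ (d + r)) (qv ^ d) k ^ (d - r - 1) * qShifted (qv ^ r) (qv ^ d) k ^ (r + 1)
            * qv ^ (d * k) / qShifted (qv ^ d) (qv ^ d) k ^ d)
        ((1 - qv ^ r) ^ (r + 1) * qShifted (qv ^ d) (qv ^ d) (n - 1 - (n + r) / d)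
            / ((-1) ^ (n - 1 - (n + r) / d) * qShifted (qv ^ d) (qv ^ d) ((n + r) / d) ^ (d - 1))
          * qv ^ (exponentA d n r - r))) ∧
    -- the case `r = 1` with `d` even
    (∀ d n : ℕ, 4 ≤ d → Even d → 0 < n → (n : ℤ) ≡ -1 [ZMOD (d : ℤ)] →
      RatCongr (Polynomial.cyclotomic n ℚ ^ 2)
        (∑ k ∈ Finset.range n,
          qShifted (qv ^ (d + 1)) (qv ^ d) k ^ (d - 2) * qShifted qv (qv ^ d) k ^ 2
            * qv ^ (d * k) / qShifted (qv ^ d) (qv ^ d) k ^ d)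
        ((1 - qv) ^ 2 * qShifted (qv ^ d) (qv ^ d) (n - 1 - (n + 1) / d)
            / ((-1) ^ ((n + 1) / d) * qShifted (qv ^ d) (qv ^ d) ((n + 1) / d) ^ (d - 1))
          * qv ^ (((d : ℤ) * (d + n) * (n + 1) - (n + 1) ^ 2) / (2 * d) - 2))) ∧
    -- the case `r = 1` with `d` odd
    (∀ d n : ℕ, 3 ≤ d → Odd d → 0 < n → (n : ℤ) ≡ -1 [ZMOD (d : ℤ)] →
      RatCongr (Polynomial.cyclotomic n ℚ ^ 2)
        (∑ k ∈ Finset.range n,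
          qShifted (qv ^ (d + 1)) (qv ^ d) k ^ (d - 2) * qShifted qv (qv ^ d) k ^ 2
            * qv ^ (d * k) / qShifted (qv ^ d) (qv ^ d) k ^ d)
        ((1 - qv) ^ 2 * qShifted (qv ^ d) (qv ^ d) (n - 1 - (n + 1) / d)
            / qShifted (qv ^ d) (qv ^ d) ((n + 1) / d) ^ (d - 1)
          * qv ^ (((d : ℤ) * (d + n) * (n + 1) - (n + 1) ^ 2) / (2 * d) - 2))) := by
  refine ⟨fun d r n hr hrd hdr hn hmod => ratCongr_sum_qShifted hr hrd hdr hn hmod,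
    fun d n hd hdeven hn hmod => ?_, fun d n hd hdodd hn hmod => ?_⟩
  · obtain ⟨m, hm⟩ : d ∣ n + 1 := by
      have h := hmod.symm.dvd
      rw [sub_neg_eq_add] at h
      exact_mod_cast h
    have hdn : d ≤ n + 1 := Nat.le_of_dvd (Nat.succ_pos n) ⟨m, hm⟩
    have h := ratCongr_sum_qShifted le_rfl (by omega : 1 < d) (Nat.gcd_one_right d)
      (by omega : 1 < n) (by simpa using hmod)
    have hsign : (-1 : RatFunc ℚ) ^ (n - 1 - (n + 1) / d) = (-1) ^ ((n + 1) / d) := by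
      have hle : 4 * m ≤ n + 1 := hm ▸ Nat.mul_le_mul_right m hd
      have hodd : Even (n + 1) := hm ▸ hdeven.mul_right m
      rw [hm, Nat.mul_div_cancel_left _ (by omega)]
      refine neg_one_pow_congr ?_
      rw [Nat.even_iff] at hodd
      rw [Nat.even_iff, Nat.even_iff]
      omega
    rw [hsign, Nat.cast_one, exponentA_one_sub_one] at h
    simpa only [Nat.sub_sub, pow_one] using h
  · obtain ⟨m, hm⟩ : d ∣ n + 1 := by
      have h := hmod.symm.dvd
      rw [sub_neg_eq_add] at h
      exact_mod_cast h
    have hdn : d ≤ n + 1 := Nat.le_of_dvd (Nat.succ_pos n) ⟨m, hm⟩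
    have h := ratCongr_sum_qShifted le_rfl (by omega : 1 < d) (Nat.gcd_one_right d)
      (by omega : 1 < n) (by simpa using hmod)
    have hsign : (-1 : RatFunc ℚ) ^ (n - 1 - (n + 1) / d) = 1 := by
      obtain ⟨c, rfl⟩ := hdodd
      rw [hm, Nat.mul_div_cancel_left _ (by omega)]
      refine Even.neg_one_pow ⟨c * m - 1, ?_⟩
      rw [add_mul, one_mul, mul_assoc] at hm
      omega
    rw [hsign, one_mul, Nat.cast_one, exponentA_one_sub_one] at h
    simpa only [Nat.sub_sub, pow_one] using h
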